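/- Let $\mathcal{A}$ be an abelian category with enough projective objects, pointed by a chosen zero object $0$. An object $M$ of $\mathcal{A}$ is called Gorenstein projective if $M$ is isomorphic to a cycle object $Z_i(\mathbf{P})$ of some acyclic complex $\mathbf{P}$ of projective objects (indexed by $\mathbb{Z}$) such that $\mathrm{Hom}_{\mathcal{A}}(\mathbf{P},Q)$ is acyclic for every projective object $Q$. Let $\mathcal{GP}(\mathcal{A})$ be the full subcategory of Gorenstein projective objects, and let $\mathcal{GP}^{<\infty}(\mathcal{A})$ be the full subcategory of objects $X$ that admit, for some $n\ge 0$, an exact sequence $0\to G_n\to\cdots\to G_0\to X\to 0$ with all $G_i$ Gorenstein projective. In the Gorenstein projective model structure on $\mathcal{GP}^{<\infty}(\mathcal{A})$, cofibrations (resp. trivial cofibrations) are the monomorphisms whose cokernel is Gorenstein projective (resp. projective), trivial fibrations are the epimorphisms whose kernel has finite projective dimension, and weak equivalences are the morphisms that factor in $\mathcal{GP}^{<\infty}(\mathcal{A})$ as a trivial cofibration followed by a trivial fibration; monomorphisms, epimorphisms, kernels and cokernels are taken in $\mathcal{A}$. Call a morphism of $\mathcal{GP}(\mathcal{A})$ a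 cofibration, resp. a weak equivalence, if it is one in this model structure; so the cofibrations of $\mathcal{GP}(\mathcal{A})$ are the monomorphisms with Gorenstein projective cokernel. Then $\mathcal{GP}(\mathcal{A})$, with these cofibrations ($\rightarrowtail$) and weak equivalences, is a Waldhausen category, that is: 1. $0$ belongs to $\mathcal{GP}(\mathcal{A})$ (and is a zero object of it); isomorphisms are cofibrations; cofibrations are closed under composition; $0\rightarrowtail X$ is a cofibration for every $X$; for every cofibration $X\rightarrowtail Y$ and every map $X\to Z$ in $\mathcal{GP}(\mathcal{A})$ the pushout $Y\sqcup_X Z$ exists in $\mathcal{GP}(\mathcal{A})$ and $Z\to Y\sqcup_X Z$ is a cofibration. 2. Isomorphisms are weak equivalences; weak equivalences are closed under composition; and the gluing axiom holds: for every commutative diagram $$\begin{array}{ccccc} Y & \leftarrowtail & X & \to & Z\\ \downarrow & & \downarrow & & \downarrow\\ Y' & \leftarrowtail & X' & \to & Z' \end{array}$$ in $\mathcal{GP}(\mathcal{A})$ in which the vertical maps are weak equivalences and the two left horizontal maps are cofibrations, the induced map $Y\sqcup_X Z\to Y'\sqcup_{X'}Z'$ is a weak equivalence. Moreover, $\mathcal{GP}(\mathcal{A})$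 satisfies the saturation axiom: if $f$, $g$ are composable maps in $\mathcal{GP}(\mathcal{A})$ and two of $f$, $g$, $gf$ are weak equivalences, then so is the third. -/

import Mathlib

open CategoryTheory CategoryTheory.Limits

universe v u

namespace GorensteinWaldhausen

section Waldhausen

/-- A category `C` with a distinguished zero object `pt`, a class `cof` of cofibrations and a class
`weq` of weak equivalences is a *Waldhausen category*, i.e. a category with cofibrations and weak
equivalences. -/
structure IsWaldhausenCategory {C : Type u} [Category.{v} C] (pt : C)
    (cof weq : MorphismProperty C) : Prop where
  isZero_pt : IsZero pt
  /-- Isomorphisms are cofibrations. -/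
  cof_of_isIso : ∀ {X Y : C} (f : X ⟶ Y), IsIso f → cof f
  cof_comp : ∀ {X Y Z : C} (f : X ⟶ Y) (g : Y ⟶ Z), cof f → cof g → cof (f ≫ g)
  /-- `pt ⟶ X` is a cofibration. -/
  cof_from_pt : ∀ {X : C} (f : pt ⟶ X), cof f
  /-- Pushouts of cofibrations along arbitrary maps exist ... -/
  hasPushout_of_cof : ∀ {X Y Z : C} (f : X ⟶ Y) (g : X ⟶ Z), cof f → HasPushout f g
  /-- ... and the cobase change of a cofibration is a cofibration. -/
  cof_cobaseChange : ∀ {X Y Z W : C} {f : X ⟶ Y} {g : X ⟶ Z} {t : Y ⟶ W} {s : Z ⟶ W},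
    IsPushout f g t s → cof f → cof s
  /-- Isomorphisms are weak equivalences. -/
  weq_of_isIso : ∀ {X Y : C} (f : X ⟶ Y), IsIso f → weq f
  weq_comp : ∀ {X Y Z : C} (f : X ⟶ Y) (g : Y ⟶ Z), weq f → weq g → weq (f ≫ g)
  /-- The gluing axiom: the map `δ` induced on pushouts `Y ⊔_X Z ⟶ Y' ⊔_{X'} Z'` by weak
  equivalences `α`, `β`, `γ` is a weak equivalence. -/
  gluing : ∀ {X Y Z W X' Y' Z' W' : C}
    {f : X ⟶ Y} {g : X ⟶ Z} {t : Y ⟶ W} {s : Z ⟶ W}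
    {f' : X' ⟶ Y'} {g' : X' ⟶ Z'} {t' : Y' ⟶ W'} {s' : Z' ⟶ W'}
    {α : X ⟶ X'} {β : Y ⟶ Y'} {γ : Z ⟶ Z'} {δ : W ⟶ W'},
    IsPushout f g t s → IsPushout f' g' t' s' → cof f → cof f' →
    f ≫ β = α ≫ f' → g ≫ γ = α ≫ g' → t ≫ δ = β ≫ t' → s ≫ δ = γ ≫ s' →
    weq α → weq β → weq γ → weq δ

/-- The saturation axiom: if two of `f`, `g` and the composite `f ≫ g` are weak equivalences, then
so is the third. -/
structure SaturationAxiom {C : Type u} [Category.{v} C] (weq : MorphismProperty C) : Prop where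
  comp : ∀ {X Y Z : C} (f : X ⟶ Y) (g : Y ⟶ Z), weq f → weq g → weq (f ≫ g)
  left : ∀ {X Y Z : C} (f : X ⟶ Y) (g : Y ⟶ Z), weq g → weq (f ≫ g) → weq f
  right : ∀ {X Y Z : C} (f : X ⟶ Y) (g : Y ⟶ Z), weq f → weq (f ≫ g) → weq g

end Waldhausen

variable (A : Type u) [Category.{v} A] [Abelian A]

variable {A} in
/-- A totally acyclic complex of projectives `⋯ ⟶ P (n + 1) ⟶ P n ⟶ P (n - 1) ⟶ ⋯`: an acyclic
complex of projective objects such that the complex of abelian groups `Hom(P, Q)` is acyclic for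
every projective object `Q`. -/
structure IsTotallyAcyclic (P : ChainComplex A ℤ) : Prop where
  projective : ∀ n : ℤ, Projective (P.X n)
  acyclic : P.Acyclic
  hom_acyclic : ∀ Q : A, Projective Q →
    (((preadditiveYoneda.obj Q).mapHomologicalComplex _).obj P.op).Acyclic

/-- `GP(A)`: an object is *Gorenstein projective* if it is isomorphic to a cycle object of a totally
acyclic complex of projectives. -/
def gorensteinProjective : ObjectProperty A := fun M =>
  ∃ P : ChainComplex A ℤ, IsTotallyAcyclic P ∧ ∃ i : ℤ, Nonempty (M ≅ P.cycles i)

variable {A} in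
/-- `GpdLE n X` : there is an exact sequence `0 ⟶ Gₙ ⟶ ⋯ ⟶ G₀ ⟶ X ⟶ 0` with all `Gᵢ` Gorenstein
projective. A sequence of length `n + 1` is spliced from a short exact sequence `0 ⟶ K ⟶ G₀ ⟶ X ⟶ 0`
and a sequence of length `n` ending in the kernel `K`. -/
inductive GpdLE : ℕ → A → Prop
  | zero {X : A} : gorensteinProjective A X → GpdLE 0 X
  | succ {n : ℕ} {S : ShortComplex A} : S.ShortExact → gorensteinProjective A S.X₂ →
      GpdLE n S.X₁ → GpdLE (n + 1) S.X₃

/-- The objects of finite Gorenstein projective dimension. -/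
def finiteGpd : ObjectProperty A := fun X => ∃ n : ℕ, GpdLE n X

/-- The objects of finite projective dimension. -/
def finitePd : ObjectProperty A := fun X => ∃ n : ℕ, HasProjectiveDimensionLE X n

/-- The full subcategory `GP(A)` of `A`. -/
abbrev GP := (gorensteinProjective A).FullSubcategory

/-- The full subcategory `GP^{<∞}(A)` of `A`. -/
abbrev GPFin := (finiteGpd A).FullSubcategory

lemma gorensteinProjective_le_finiteGpd : gorensteinProjective A ≤ finiteGpd A :=
  fun _ hX => ⟨0, .zero hX⟩

/-- The inclusion functor of `GP(A)` in `GP^{<∞}(A)`. -/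
abbrev GP.incl : GP A ⥤ GPFin A :=
  ObjectProperty.ιOfLE (gorensteinProjective_le_finiteGpd A)

/-! The Gorenstein projective model structure on `GP^{<∞}(A)`. Monomorphisms, epimorphisms, kernels
and cokernels are those of `A`. -/

/-- Cofibrations: monomorphisms with Gorenstein projective cokernel. -/
def modelCof : MorphismProperty (GPFin A) := fun _ _ f =>
  Mono f.hom ∧ gorensteinProjective A (cokernel f.hom)

/-- Trivial cofibrations: monomorphisms with projective cokernel. -/
def modelTrivCof : MorphismProperty (GPFin A) := fun _ _ f =>
  Mono f.hom ∧ Projective (cokernel f.hom)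

/-- Trivial fibrations: epimorphisms whose kernel has finite projective dimension. -/
def modelTrivFib : MorphismProperty (GPFin A) := fun _ _ f =>
  Epi f.hom ∧ finitePd A (kernel f.hom)

/-- Weak equivalences: morphisms which factor, in `GP^{<∞}(A)`, as a trivial cofibration followed by
a trivial fibration. -/
def modelWeq : MorphismProperty (GPFin A) := fun X Y f =>
  ∃ (M : GPFin A) (i : X ⟶ M) (p : M ⟶ Y), modelTrivCof A i ∧ modelTrivFib A p ∧ i ≫ p = f

/-- The cofibrations of `GP(A)`: monomorphisms with Gorenstein projective cokernel. -/
def GP.cof : MorphismProperty (GP A) := (modelCof A).inverseImage (GP.incl A)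

/-- The weak equivalences of `GP(A)`: those of the Gorenstein projective model structure. -/
def GP.weq : MorphismProperty (GP A) := (modelWeq A).inverseImage (GP.incl A)

end GorensteinWaldhausen

/-! Weak equivalences between Gorenstein projectives have a homological description (`GP.weq_iff`):
they are the morphisms `f` such that `Ext (-, N)` sends `f` to a bijection in all degrees beyond a
bound independent of `N`. A trivial cofibration or trivial fibration has this property by the long
exact sequence, the cokernel or kernel having finite projective dimension. Conversely, for `f : X ⟶
Y` with this property and `P ⟶ Y` an epimorphism from a projective, `f` factors as `X ⟶ X ⊞ P ⟶ Y`,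
and the uniform bound forces the kernel of the second map to have finite projective dimension. With
this description, saturation is two-out-of-three for bijections, and gluing is the five lemma
applied to cofibrations and their cokernels, which a pushout does not change. The cofibration axioms
reduce to one fact: Gorenstein projectives contain the projectives and are closed under extensions.
Both follow from a coinductive criterion, `IsProjectivelyResolved.le_gorensteinProjective`: in a
class whose objects are resolved by projectives on both sides within the class, and have no `Ext` in
degree 1 to projectives, the resolutions splice to totally acyclic complexes. -/

namespace GorensteinWaldhausen

open CategoryTheory.Abelian

universe w

/-! ### Morphisms inducing bijections on Ext in high degrees. -/

section EventuallyExtIso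

variable {A : Type u} [Category.{v} A] [Abelian A] [HasExt.{w} A]

/-- A morphism which induces bijections on `Ext (-, N)` in all sufficiently large degrees. -/
def EventuallyExtIso {X Y : A} (f : X ⟶ Y) : Prop :=
  ∃ n : ℕ, ∀ i, n ≤ i → ∀ N : A,
    Function.Bijective ((Ext.mk₀ f).precomp N (zero_add i))

namespace EventuallyExtIso

lemma precomp_comp {X Y Z : A} (f : X ⟶ Y) (g : Y ⟶ Z) (N : A) (i : ℕ) :
    ((Ext.mk₀ (f ≫ g)).precomp N (zero_add i) : Ext Z N i → Ext X N i) =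
      (Ext.mk₀ f).precomp N (zero_add i) ∘ (Ext.mk₀ g).precomp N (zero_add i) := by
  ext x
  simp [← Ext.mk₀_comp_mk₀_assoc]

lemma of_isIso {X Y : A} (f : X ⟶ Y) [IsIso f] : EventuallyExtIso f := by
  refine ⟨0, fun i _ N => Function.bijective_iff_has_inverse.2
    ⟨(Ext.mk₀ (inv f)).precomp N (zero_add i), fun x => ?_, fun x => ?_⟩⟩
  · rw [← Function.comp_apply (f := (Ext.mk₀ (inv f)).precomp N (zero_add i)), ← precomp_comp]
    simp
  · rw [← Function.comp_apply (f := (Ext.mk₀ f).precomp N (zero_add i)), ← precomp_comp]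
    simp

lemma comp {X Y Z : A} {f : X ⟶ Y} {g : Y ⟶ Z} (hf : EventuallyExtIso f)
    (hg : EventuallyExtIso g) : EventuallyExtIso (f ≫ g) := by
  obtain ⟨n, hn⟩ := hf
  obtain ⟨m, hm⟩ := hg
  refine ⟨max n m, fun i hi N => ?_⟩
  rw [precomp_comp]
  exact (hn i (by lia) N).comp (hm i (by lia) N)

lemma of_comp_left {X Y Z : A} {f : X ⟶ Y} {g : Y ⟶ Z} (hg : EventuallyExtIso g)
    (h : EventuallyExtIso (f ≫ g)) : EventuallyExtIso f := by
  obtain ⟨n, hn⟩ := h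
  obtain ⟨m, hm⟩ := hg
  refine ⟨max n m, fun i hi N => ?_⟩
  have := hn i (by lia) N
  rw [precomp_comp] at this
  exact (Function.Bijective.of_comp_iff _ (hm i (by lia) N)).1 this

lemma of_comp_right {X Y Z : A} {f : X ⟶ Y} {g : Y ⟶ Z} (hf : EventuallyExtIso f)
    (h : EventuallyExtIso (f ≫ g)) : EventuallyExtIso g := by
  obtain ⟨n, hn⟩ := h
  obtain ⟨m, hm⟩ := hf
  refine ⟨max n m, fun i hi N => ?_⟩
  have := hn i (by lia) N
  rw [precomp_comp] at this
  exact (Function.Bijective.of_comp_iff' (hm i (by lia) N) _).1 this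

lemma of_shortExact_of_finitePd_X₁ {X Y Z : A} {f : X ⟶ Y} {g : Y ⟶ Z} {w : f ≫ g = 0}
    (hS : (ShortComplex.mk f g w).ShortExact)
    (h : finitePd A X) : EventuallyExtIso g := by
  obtain ⟨n, hn⟩ := h
  -- The kernel of `Ext Z N i ⟶ Ext Y N i` comes from `Ext X N (i - 1)`, which must already vanish,
  -- so `i - 1 ≥ n + 1`.
  refine ⟨n + 2, fun i hi N => ⟨?_, fun x => ?_⟩⟩
  · rw [injective_iff_map_eq_zero]
    intro x hx
    obtain ⟨y, rfl⟩ := Ext.contravariant_sequence_exact₃ hS _ x hx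
      (show 1 + (i - 1) = i by lia)
    rw [y.eq_zero_of_hasProjectiveDimensionLT (n + 1) (by lia), Ext.comp_zero]
  · exact Ext.contravariant_sequence_exact₂ hS _ x
      (Ext.eq_zero_of_hasProjectiveDimensionLT _ (n + 1) (by lia))

lemma of_shortExact_of_finitePd_X₃ {X Y Z : A} {f : X ⟶ Y} {g : Y ⟶ Z} {w : f ≫ g = 0}
    (hS : (ShortComplex.mk f g w).ShortExact)
    (h : finitePd A Z) : EventuallyExtIso f := by
  obtain ⟨n, hn⟩ := h
  refine ⟨n + 1, fun i hi N => ⟨?_, fun x => ?_⟩⟩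
  · rw [injective_iff_map_eq_zero]
    intro x hx
    obtain ⟨y, rfl⟩ := Ext.contravariant_sequence_exact₂ hS _ x hx
    rw [y.eq_zero_of_hasProjectiveDimensionLT (n + 1) (by lia), Ext.comp_zero]
  · exact Ext.contravariant_sequence_exact₁ hS _ x rfl
      (Ext.eq_zero_of_hasProjectiveDimensionLT _ (n + 1) (by lia))

/-- In the long exact sequence, injectivity in degree `1 + i` kills the connecting map out of `Ext X
N i`, and surjectivity in degree `i` kills the map into it. The bound does not depend on `N`, so it
bounds the projective dimension. -/
lemma finitePd_X₁ {X Y Z : A} {f : X ⟶ Y} {g : Y ⟶ Z} {w : f ≫ g = 0}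
    (hS : (ShortComplex.mk f g w).ShortExact)
    (h : EventuallyExtIso g) : finitePd A X := by
  obtain ⟨n, hn⟩ := h
  refine ⟨n, (hasProjectiveDimensionLT_iff _ _).2 fun i hi N x => ?_⟩
  obtain ⟨y, rfl⟩ := Ext.contravariant_sequence_exact₁ hS _ x (rfl : 1 + i = 1 + i) (by
    apply (hn (1 + i) (by lia) N).1
    rw [map_zero]
    exact hS.comp_extClass_assoc x rfl)
  obtain ⟨z, rfl⟩ := (hn i (by lia) N).2 y
  simp [w]

lemma precomp_extClass_naturality {S T : ShortComplex A} (hS : S.ShortExact) (hT : T.ShortExact)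
    (φ : S ⟶ T)
    (N : A) {i j : ℕ} (h : 1 + i = j) :
    (hS.extClass.precomp N h).comp ((Ext.mk₀ φ.τ₁).precomp N (zero_add i)) =
      ((Ext.mk₀ φ.τ₃).precomp N (zero_add j)).comp (hT.extClass.precomp N h) := by
  ext x
  have := congr_arg (fun y => y.comp x h)
    (ShortComplex.ShortExact.extClass_naturality hS hT φ)
  rw [Ext.comp_assoc_of_second_deg_zero] at this
  exact this.trans (Ext.comp_assoc _ _ _ (zero_add 1) h (by lia))

lemma precomp_naturality {X Y X' Y' : A} {f : X ⟶ Y} {f' : X' ⟶ Y'} {a : X ⟶ X'} {b : Y ⟶ Y'}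
    (w : f ≫ b = a ≫ f') (N : A) (i : ℕ) :
    ((Ext.mk₀ f).precomp N (zero_add i)).comp ((Ext.mk₀ b).precomp N (zero_add i)) =
      ((Ext.mk₀ a).precomp N (zero_add i)).comp ((Ext.mk₀ f').precomp N (zero_add i)) := by
  apply DFunLike.coe_injective
  simp only [AddMonoidHom.coe_comp, ← precomp_comp, w]

/-- Five lemma on the contravariant long exact sequences; the window reaches down to degree `i - 1`,
whence the `+ 1` in the bound. -/
lemma τ₃ {S T : ShortComplex A} (hS : S.ShortExact) (hT : T.ShortExact)
    (φ : S ⟶ T)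
    (h₁ : EventuallyExtIso φ.τ₁) (h₂ : EventuallyExtIso φ.τ₂) :
    EventuallyExtIso φ.τ₃ := by
  obtain ⟨n, hn⟩ := h₁
  obtain ⟨m, hm⟩ := h₂
  refine ⟨max n m + 1, fun i hi N => ?_⟩
  have hj : 1 + (i - 1) = i := by lia
  exact AddMonoidHom.bijective_of_surjective_of_bijective_of_bijective_of_injective
    _ _ _ _ _ _ _ _ _ _ _ _ _
    (precomp_naturality φ.comm₁₂.symm N (i - 1))
    (precomp_extClass_naturality hS hT φ N hj)
    (precomp_naturality φ.comm₂₃.symm N i)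
    (precomp_naturality φ.comm₁₂.symm N i)
    ((ShortComplex.ab_exact_iff_function_exact _).1
      (Ext.contravariant_sequence_exact₁' hT N _ _ hj))
    ((ShortComplex.ab_exact_iff_function_exact _).1
      (Ext.contravariant_sequence_exact₃' hT N _ _ hj))
    ((ShortComplex.ab_exact_iff_function_exact _).1
      (Ext.contravariant_sequence_exact₂' hT N i))
    ((ShortComplex.ab_exact_iff_function_exact _).1
      (Ext.contravariant_sequence_exact₁' hS N _ _ hj))
    ((ShortComplex.ab_exact_iff_function_exact _).1
      (Ext.contravariant_sequence_exact₃' hS N _ _ hj))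
    ((ShortComplex.ab_exact_iff_function_exact _).1
      (Ext.contravariant_sequence_exact₂' hS N i))
    (hm _ (by lia) N).2 (hn _ (by lia) N) (hm _ (by lia) N) (hn _ (by lia) N).1

lemma τ₂ {S T : ShortComplex A} (hS : S.ShortExact) (hT : T.ShortExact)
    (φ : S ⟶ T)
    (h₁ : EventuallyExtIso φ.τ₁) (h₃ : EventuallyExtIso φ.τ₃) :
    EventuallyExtIso φ.τ₂ := by
  obtain ⟨n, hn⟩ := h₁
  obtain ⟨m, hm⟩ := h₃
  refine ⟨max n m + 1, fun i hi N => ?_⟩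
  have hj : 1 + (i - 1) = i := by lia
  exact AddMonoidHom.bijective_of_surjective_of_bijective_of_bijective_of_injective
    _ _ _ _ _ _ _ _ _ _ _ _ _
    (precomp_extClass_naturality hS hT φ N hj)
    (precomp_naturality φ.comm₂₃.symm N i)
    (precomp_naturality φ.comm₁₂.symm N i)
    (precomp_extClass_naturality hS hT φ N (rfl : 1 + i = 1 + i))
    ((ShortComplex.ab_exact_iff_function_exact _).1
      (Ext.contravariant_sequence_exact₃' hT N _ _ hj))
    ((ShortComplex.ab_exact_iff_function_exact _).1
      (Ext.contravariant_sequence_exact₂' hT N i))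
    ((ShortComplex.ab_exact_iff_function_exact _).1
      (Ext.contravariant_sequence_exact₁' hT N _ _ rfl))
    ((ShortComplex.ab_exact_iff_function_exact _).1
      (Ext.contravariant_sequence_exact₃' hS N _ _ hj))
    ((ShortComplex.ab_exact_iff_function_exact _).1
      (Ext.contravariant_sequence_exact₂' hS N i))
    ((ShortComplex.ab_exact_iff_function_exact _).1
      (Ext.contravariant_sequence_exact₁' hS N _ _ rfl))
    (hn _ (by lia) N).2 (hm _ (by lia) N) (hn _ (by lia) N) (hm _ (by lia) N).1

end EventuallyExtIso

end EventuallyExtIso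

end GorensteinWaldhausen

namespace GorensteinWaldhausen

open CategoryTheory.Abelian

universe w

/-! ### Three-by-three lemmas. -/

section Diagrams

variable {A : Type u} [Category.{v} A] [Abelian A]

/-- The cokernels of a termwise monic morphism of short exact sequences form a short exact
sequence. -/
lemma exists_shortExact_of_mono {S T : ShortComplex A} (hS : S.ShortExact) (hT : T.ShortExact)
    (φ : S ⟶ T) [Mono φ.τ₁] [Mono φ.τ₃] :
    ∃ (R : ShortComplex A) (ψ : T ⟶ R) (w : φ ≫ ψ = 0), R.ShortExact ∧
      (ShortComplex.mk φ.τ₁ ψ.τ₁ (by rw [← ShortComplex.comp_τ₁, w]; rfl)).ShortExact ∧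
      (ShortComplex.mk φ.τ₂ ψ.τ₂ (by rw [← ShortComplex.comp_τ₂, w]; rfl)).ShortExact ∧
      (ShortComplex.mk φ.τ₃ ψ.τ₃ (by rw [← ShortComplex.comp_τ₃, w]; rfl)).ShortExact := by
  have := hS.epi_g
  have := hT.epi_g
  have := hS.mono_f
  have := hT.mono_f
  let D : ShortComplex.SnakeInput A :=
    { L₀ := kernel φ
      L₁ := S
      L₂ := T
      L₃ := cokernel φ
      v₀₁ := kernel.ι φ
      v₁₂ := φ
      v₂₃ := cokernel.π φ
      w₀₂ := kernel.condition φ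
      w₁₃ := cokernel.condition φ
      h₀ := kernelIsKernel φ
      h₃ := cokernelIsCokernel φ
      L₁_exact := hS.exact
      epi_L₁_g := inferInstance
      L₂_exact := hT.exact
      mono_L₂_f := inferInstance }
  have h₂ : Mono φ.τ₂ := ShortComplex.mono_τ₂_of_exact_of_mono φ hS.exact
  have e₁ : Epi (cokernel.π φ).τ₁ := D.epi_v₂₃_τ₁
  have e₂ : Epi (cokernel.π φ).τ₂ := D.epi_v₂₃_τ₂
  have e₃ : Epi (cokernel.π φ).τ₃ := D.epi_v₂₃_τ₃
  have hg : Epi (cokernel φ).g := by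
    have : Epi ((cokernel.π φ).τ₂ ≫ (cokernel φ).g) := by
      rw [(cokernel.π φ).comm₂₃]; infer_instance
    exact epi_of_epi (cokernel.π φ).τ₂ _
  have hf : Mono (cokernel φ).f := by
    -- The connecting morphism of the snake lemma starts at the kernel of `φ.τ₃`, which is zero.
    refine D.L₂'_exact.mono_g ?_
    have : D.v₀₁.τ₃ = 0 := by
      have : D.v₀₁.τ₃ ≫ φ.τ₃ = 0 := D.w₀₂_τ₃
      exact (cancel_mono φ.τ₃).1 (by rw [this, zero_comp])
    have hm := D.mono_v₀₁_τ₃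
    exact (IsZero.of_mono_eq_zero _ this).eq_of_src _ _
  refine ⟨cokernel φ, cokernel.π φ, cokernel.condition φ, ⟨D.L₃_exact⟩, ⟨D.exact_C₁_down⟩,
    ⟨D.exact_C₂_down⟩, ⟨D.exact_C₃_down⟩⟩

/-- The kernels of a termwise epic morphism of short exact sequences form a short exact
sequence. -/
lemma exists_shortExact_of_epi {S T : ShortComplex A} (hS : S.ShortExact) (hT : T.ShortExact)
    (φ : S ⟶ T) [Epi φ.τ₁] [Epi φ.τ₃] :
    ∃ (R : ShortComplex A) (ψ : R ⟶ S) (w : ψ ≫ φ = 0), R.ShortExact ∧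
      (ShortComplex.mk ψ.τ₁ φ.τ₁ (by rw [← ShortComplex.comp_τ₁, w]; rfl)).ShortExact ∧
      (ShortComplex.mk ψ.τ₂ φ.τ₂ (by rw [← ShortComplex.comp_τ₂, w]; rfl)).ShortExact ∧
      (ShortComplex.mk ψ.τ₃ φ.τ₃ (by rw [← ShortComplex.comp_τ₃, w]; rfl)).ShortExact := by
  have := hS.epi_g
  have := hT.epi_g
  have := hS.mono_f
  have := hT.mono_f
  let D : ShortComplex.SnakeInput A :=
    { L₀ := kernel φ
      L₁ := S
      L₂ := T
      L₃ := cokernel φ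
      v₀₁ := kernel.ι φ
      v₁₂ := φ
      v₂₃ := cokernel.π φ
      w₀₂ := kernel.condition φ
      w₁₃ := cokernel.condition φ
      h₀ := kernelIsKernel φ
      h₃ := cokernelIsCokernel φ
      L₁_exact := hS.exact
      epi_L₁_g := inferInstance
      L₂_exact := hT.exact
      mono_L₂_f := inferInstance }
  have h₂ : Epi φ.τ₂ := ShortComplex.epi_τ₂_of_exact_of_epi φ hT.exact
  have e₁ : Mono (kernel.ι φ).τ₁ := D.mono_v₀₁_τ₁
  have e₂ : Mono (kernel.ι φ).τ₂ := D.mono_v₀₁_τ₂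
  have e₃ : Mono (kernel.ι φ).τ₃ := D.mono_v₀₁_τ₃
  have hf : Mono (kernel φ).f := by
    have : Mono ((kernel φ).f ≫ (kernel.ι φ).τ₂) := by
      rw [← (kernel.ι φ).comm₁₂]; infer_instance
    exact mono_of_mono _ (kernel.ι φ).τ₂
  have hg : Epi (kernel φ).g := by
    -- Dually, the connecting morphism ends at the cokernel of `φ.τ₁`, which is zero.
    refine D.L₁'_exact.epi_f ?_
    have : D.v₂₃.τ₁ = 0 := by
      have : φ.τ₁ ≫ D.v₂₃.τ₁ = 0 := D.w₁₃_τ₁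
      exact (cancel_epi φ.τ₁).1 (by rw [this, comp_zero])
    have hm := D.epi_v₂₃_τ₁
    exact (IsZero.of_epi_eq_zero _ this).eq_of_tgt _ _
  refine ⟨kernel φ, kernel.ι φ, kernel.condition φ, ⟨D.L₀_exact⟩, ⟨D.exact_C₁_up⟩,
    ⟨D.exact_C₂_up⟩, ⟨D.exact_C₃_up⟩⟩

lemma shortExact_biprod (X Y : A) :
    (ShortComplex.mk (biprod.inl : X ⟶ X ⊞ Y) biprod.snd (by simp)).ShortExact :=
  (ShortComplex.Splitting.ofHasBinaryBiproduct X Y).shortExact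

end Diagrams

/-- Chosen predecessors and successors are iterated from `a` in both directions; this supplies the
sequence of objects to be spliced. -/
lemma exists_int_chain {α : Type*} {R : α → α → Prop} (hl : ∀ a, ∃ b, R b a)
    (hr : ∀ a, ∃ b, R a b) (a : α) : ∃ f : ℤ → α, f 0 = a ∧ ∀ n, R (f (n + 1)) (f n) := by
  choose l hl using hl
  choose r hr using hr
  let f : ℤ → α := fun
    | .ofNat n => l^[n] a
    | .negSucc n => r^[n + 1] a
  refine ⟨f, rfl, ?_⟩
  rintro (k | k)
  · change R (l^[k + 1] a) (l^[k] a)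
    rw [Function.iterate_succ_apply']
    exact hl _
  · obtain _ | k := k
    · exact hr _
    · change R (r^[k + 1] a) (r^[k + 2] a)
      rw [Function.iterate_succ_apply' _ (k + 1)]
      exact hr _

/-! ### Elementwise exactness conditions, and Ext in degree 1 as an obstruction to extension. -/

section TotallyAcyclic

variable {A : Type u} [Category.{v} A] [Abelian A]

lemma acyclic_iff_sc' (P : ChainComplex A ℤ) :
    P.Acyclic ↔ ∀ m : ℤ, (P.sc' (m + 2) (m + 1) m).Exact := by
  refine ⟨fun h m => ?_, fun h j => ?_⟩
  · exact (P.exactAt_iff' (m + 2) (m + 1) m (by simp; ring) (by simp)).1 (h (m + 1))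
  · obtain ⟨m, rfl⟩ : ∃ m, j = m + 1 := ⟨j - 1, by simp⟩
    exact (P.exactAt_iff' (m + 2) (m + 1) m (by simp; ring) (by simp)).2 (h m)

lemma hom_acyclic_iff (P : ChainComplex A ℤ) (Q : A) :
    (((preadditiveYoneda.obj Q).mapHomologicalComplex _).obj P.op).Acyclic ↔
      ∀ (m : ℤ) (x : P.X (m + 1) ⟶ Q), P.d (m + 2) (m + 1) ≫ x = 0 →
        ∃ y : P.X m ⟶ Q, P.d (m + 1) m ≫ y = x := by
  have key (m : ℤ) : (((preadditiveYoneda.obj Q).mapHomologicalComplex _).obj P.op).ExactAt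
      (m + 1) ↔ ∀ (x : P.X (m + 1) ⟶ Q), P.d (m + 2) (m + 1) ≫ x = 0 →
        ∃ y : P.X m ⟶ Q, P.d (m + 1) m ≫ y = x := by
    rw [HomologicalComplex.exactAt_iff' _ m (m + 1) (m + 2)
      (ComplexShape.prev_eq' _ (by simp)) (ComplexShape.next_eq' _ (by simp; ring)),
      ShortComplex.ab_exact_iff]
    rfl
  refine ⟨fun h m => (key m).1 (h (m + 1)), fun h j => ?_⟩
  obtain ⟨m, rfl⟩ : ∃ m, j = m + 1 := ⟨j - 1, by simp⟩
  exact (key m).2 (h m)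

variable [HasExt.{w} A]

/-- Morphisms to `Q` extend along a monomorphism whose cokernel `M` satisfies `Ext M Q 1 = 0`. -/
lemma exists_extension {S : ShortComplex A} (hS : S.ShortExact) {Q : A}
    (h : ∀ e : Ext S.X₃ Q 1, e = 0) (x : S.X₁ ⟶ Q) : ∃ y : S.X₂ ⟶ Q, S.f ≫ y = x := by
  obtain ⟨y, hy⟩ := Ext.contravariant_sequence_exact₁ hS Q (Ext.mk₀ x) (add_zero 1) (h _)
  obtain ⟨y, rfl⟩ := Ext.homEquiv₀.symm.surjective y
  exact ⟨y, Ext.homEquiv₀.symm.injective (by simpa using hy)⟩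

/-- Dimension shift: since `S.X₂` is projective, `Ext S.X₃ Q 1` is the cokernel of restriction along
`S.f`. -/
lemma ext_eq_zero_of_extension {S : ShortComplex A} (hS : S.ShortExact) {Q : A}
    [Projective S.X₂] (h : ∀ x : S.X₁ ⟶ Q, ∃ y : S.X₂ ⟶ Q, S.f ≫ y = x) (e : Ext S.X₃ Q 1) :
    e = 0 := by
  obtain ⟨x, rfl⟩ := Ext.contravariant_sequence_exact₃ hS Q e (Ext.eq_zero_of_projective _)
    (add_zero 1)
  obtain ⟨x, rfl⟩ := Ext.homEquiv₀.symm.surjective x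
  obtain ⟨y, rfl⟩ := h x
  change hS.extClass.comp (Ext.mk₀ (S.f ≫ y)) _ = 0
  rw [← Ext.mk₀_comp_mk₀]
  exact ShortComplex.ShortExact.extClass_comp_assoc hS _

end TotallyAcyclic

end GorensteinWaldhausen

/-! ### A coinductive criterion for Gorenstein projectivity. -/

namespace GorensteinWaldhausen

open CategoryTheory.Abelian

universe w

variable {A : Type u} [Category.{v} A] [Abelian A]

/-- A class of objects `M` with `Ext M Q 1 = 0` for all projective `Q`, each of which is both a
quotient of a projective object by, and a subobject of a projective object with cokernel, an
object of the class. -/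
structure IsProjectivelyResolved [HasExt.{w} A] (W : ObjectProperty A) : Prop where
  ext_eq_zero : ∀ {M : A}, W M → ∀ (Q : A) [Projective Q] (e : Ext M Q 1), e = 0
  exists_left : ∀ {M : A}, W M → ∃ (K P : A) (i : K ⟶ P) (p : P ⟶ M) (w : i ≫ p = 0),
    W K ∧ Projective P ∧ (ShortComplex.mk i p w).ShortExact
  exists_right : ∀ {M : A}, W M → ∃ (P C : A) (i : M ⟶ P) (p : P ⟶ C) (w : i ≫ p = 0),
    W C ∧ Projective P ∧ (ShortComplex.mk i p w).ShortExact

section Splice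

variable {F P : ℤ → A} {i : ∀ n, F (n + 1) ⟶ P n} {p : ∀ n, P n ⟶ F n} {w : ∀ n, i n ≫ p n = 0}
  (h : ∀ n, (ShortComplex.mk (i n) (p n) (w n)).ShortExact)

/-- The complex obtained by splicing short exact sequences `0 ⟶ F (n + 1) ⟶ P n ⟶ F n ⟶ 0`. -/
noncomputable abbrev splice (i : ∀ n, F (n + 1) ⟶ P n) (p : ∀ n, P n ⟶ F n)
    (w : ∀ n, i n ≫ p n = 0) : ChainComplex A ℤ :=
  ChainComplex.of P (fun n => p (n + 1) ≫ i n) (fun n => by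
    rw [Category.assoc, reassoc_of% (w (n + 1)), zero_comp, comp_zero])

lemma splice_d (n : ℤ) : (splice i p w).d (n + 1) n = p (n + 1) ≫ i n :=
  ChainComplex.of_d P (fun n => p (n + 1) ≫ i n) n

include h

lemma splice_acyclic : (splice i p w).Acyclic := by
  rw [acyclic_iff_sc']
  intro m
  -- `m + 2` is replaced by `m + 1 + 1`, the form of index to which `splice_d` applies.
  suffices ∀ k, k = m + 1 + 1 → ((splice i p w).sc' k (m + 1) m).Exact from this _ (by ring)
  rintro _ rfl
  -- `T` differs from the spliced complex by a monomorphism on the right (`φ`), and from the given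
  -- short exact sequence by an epimorphism on the left (`ψ`); neither affects exactness in the
  -- middle.
  let T := ShortComplex.mk (p (m + 1 + 1) ≫ i (m + 1)) (p (m + 1)) (by simp [w])
  let φ : T ⟶ (splice i p w).sc' (m + 1 + 1) (m + 1) m :=
    { τ₁ := 𝟙 _
      τ₂ := 𝟙 _
      τ₃ := i m
      comm₁₂ := (Category.id_comp _).trans ((splice_d (w := w) _).trans (Category.comp_id _).symm)
      comm₂₃ := (Category.id_comp _).trans (splice_d (w := w) _) }
  let ψ : T ⟶ ShortComplex.mk (i (m + 1)) (p (m + 1)) (w (m + 1)) :=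
    { τ₁ := p (m + 1 + 1)
      τ₂ := 𝟙 _
      τ₃ := 𝟙 _ }
  have : Epi φ.τ₁ := inferInstanceAs (Epi (𝟙 _))
  have : IsIso φ.τ₂ := inferInstanceAs (IsIso (𝟙 _))
  have : Mono φ.τ₃ := (h m).mono_f
  have : Epi ψ.τ₁ := (h (m + 1 + 1)).epi_g
  have : IsIso ψ.τ₂ := inferInstanceAs (IsIso (𝟙 _))
  have : Mono ψ.τ₃ := inferInstanceAs (Mono (𝟙 _))
  rw [← ShortComplex.exact_iff_of_epi_of_isIso_of_mono φ,
    ShortComplex.exact_iff_of_epi_of_isIso_of_mono ψ]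
  exact (h (m + 1)).exact

/-- A cocycle `x : P (m + 1) ⟶ Q` kills `i (m + 1)`, hence factors through `F (m + 1)`; the factor
extends along `i m` because `Ext (F m) Q 1` vanishes. -/
lemma splice_isTotallyAcyclic [HasExt.{w} A] [∀ n, Projective (P n)]
    (hF : ∀ n (Q : A) [Projective Q] (e : Ext (F n) Q 1), e = 0) :
    IsTotallyAcyclic (splice i p w) where
  projective n := inferInstanceAs (Projective (P n))
  acyclic := splice_acyclic h
  hom_acyclic Q hQ := by
    rw [hom_acyclic_iff]
    intro m x hx
    replace hx : (splice i p w).d (m + 1 + 1) (m + 1) ≫ x = 0 := by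
      have e : m + 2 = m + 1 + 1 := by ring
      rwa [e] at hx
    have := (h (m + 1 + 1)).epi_g
    have := (h (m + 1)).epi_g
    rw [splice_d, Category.assoc] at hx
    replace hx : i (m + 1) ≫ x = 0 :=
      (cancel_epi (p (m + 1 + 1))).1 (by rw [hx, comp_zero])
    obtain ⟨z, hz⟩ := exists_extension (h m) (hF m Q) ((h (m + 1)).exact.desc x hx)
    refine ⟨z, ?_⟩
    rw [splice_d, Category.assoc]
    dsimp at hz
    rw [hz]
    exact (h (m + 1)).exact.g_desc x hx

lemma nonempty_iso_cycles_splice (n : ℤ) :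
    Nonempty (F (n + 1 + 1) ≅ (splice i p w).cycles (n + 1)) := by
  have : Mono (i (n + 1)) := (h (n + 1)).mono_f
  have : Mono (i n) := (h n).mono_f
  have hk : IsLimit (KernelFork.ofι (f := (splice i p w).d (n + 1) n) (i (n + 1)) (by
      rw [splice_d, reassoc_of% (w (n + 1)), zero_comp])) :=
    KernelFork.IsLimit.ofι' _ _ fun {T} k hk => by
      have hk' : k ≫ p (n + 1) = 0 := by
        rw [← cancel_mono (i n), zero_comp, Category.assoc, ← splice_d]
        exact hk
      exact ⟨(h (n + 1)).exact.lift k hk', (h (n + 1)).exact.lift_f k hk'⟩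
  exact ⟨hk.conePointUniqueUpToIso ((splice i p w).cyclesIsKernel (n + 1) n (by simp))⟩

end Splice

namespace IsProjectivelyResolved

variable [HasExt.{w} A]

lemma le_gorensteinProjective {W : ObjectProperty A} (hW : IsProjectivelyResolved W) :
    W ≤ gorensteinProjective A := by
  intro M hM
  let R (a b : Subtype W) : Prop :=
    ∃ (P : A) (i : a.1 ⟶ P) (p : P ⟶ b.1) (w : i ≫ p = 0),
      Projective P ∧ (ShortComplex.mk i p w).ShortExact
  obtain ⟨F, hF, hR⟩ := exists_int_chain (R := R)
    (fun a => by
      obtain ⟨K, P, i, p, w, hK, hP, h⟩ := hW.exists_left a.2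
      exact ⟨⟨K, hK⟩, P, i, p, w, hP, h⟩)
    (fun a => by
      obtain ⟨P, C, i, p, w, hC, hP, h⟩ := hW.exists_right a.2
      exact ⟨⟨C, hC⟩, P, i, p, w, hP, h⟩) ⟨M, hM⟩
  choose P i p w hP h using hR
  -- The value `-2` makes the index `n + 1 + 1` equal to `0`, where the chain passes through `M`.
  obtain ⟨e⟩ := nonempty_iso_cycles_splice (F := fun n => (F n).1) h (-2)
  exact ⟨_, splice_isTotallyAcyclic (F := fun n => (F n).1) h
    (fun n Q _ => hW.ext_eq_zero (F n).2 Q), _,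
    ⟨eqToIso (congr_arg Subtype.val hF.symm) ≪≫ e⟩⟩

end IsProjectivelyResolved

end GorensteinWaldhausen

/-! ### Projectives and extensions among Gorenstein projectives. -/

namespace GorensteinWaldhausen

open CategoryTheory.Abelian

universe w

variable {A : Type u} [Category.{v} A] [Abelian A]

lemma shortExact_comp_iso {X Y Z Z' : A} {f : X ⟶ Y} {g : Y ⟶ Z} {w : f ≫ g = 0}
    (h : (ShortComplex.mk f g w).ShortExact) (e : Z ≅ Z') :
    (ShortComplex.mk f (g ≫ e.hom) (by rw [reassoc_of% w, zero_comp])).ShortExact :=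
  ShortComplex.shortExact_of_iso (S₁ := ShortComplex.mk f g w)
    (ShortComplex.isoMk (Iso.refl _) (Iso.refl _) e (by simp) (by simp)) h

lemma shortExact_iso_comp {X X' Y Z : A} {f : X ⟶ Y} {g : Y ⟶ Z} {w : f ≫ g = 0}
    (h : (ShortComplex.mk f g w).ShortExact) (e : X' ≅ X) :
    (ShortComplex.mk (e.hom ≫ f) g (by rw [Category.assoc, w, comp_zero])).ShortExact :=
  ShortComplex.shortExact_of_iso (S₁ := ShortComplex.mk f g w)
    (ShortComplex.isoMk e.symm (Iso.refl _) (Iso.refl _) (by simp) (by simp)) h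

section Cycles

variable {P : ChainComplex A ℤ}

lemma shortExact_cycles (hP : P.Acyclic) (n : ℤ) :
    (ShortComplex.mk (P.iCycles (n + 1)) (P.toCycles (n + 1) n)
      (by simp [← cancel_mono (P.iCycles n)])).ShortExact where
  exact := by
    refine ShortComplex.exact_of_f_is_kernel _ (KernelFork.IsLimit.ofι' _ _ fun k hk => ?_)
    dsimp at k hk
    have hk' : k ≫ P.d (n + 1) n = 0 := by
      rw [← P.toCycles_i, reassoc_of% hk, zero_comp]
    exact ⟨P.liftCycles k n (by simp) hk', P.liftCycles_i _ _ _ _⟩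
  mono_f := inferInstanceAs (Mono (P.iCycles (n + 1)))
  epi_g := Preadditive.epi_of_isZero_cokernel' _
    (P.homologyIsCokernel (n + 1) n (by simp)) (hP n).isZero_homology

variable [HasExt.{w} A]

/-- By dimension shift, it suffices to extend maps from cycles to `Q`. Precomposed with the
epimorphism onto the cycles, such a map becomes a cocycle of `Hom(P, Q)`, hence a coboundary, which
yields the extension. -/
lemma IsTotallyAcyclic.ext_cycles_eq_zero (hP : IsTotallyAcyclic P) (n : ℤ) (Q : A)
    [Projective Q] (e : Ext (P.cycles n) Q 1) : e = 0 := by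
  have := hP.projective (n + 1)
  refine ext_eq_zero_of_extension (shortExact_cycles hP.acyclic n) (fun x => ?_) e
  have := (shortExact_cycles hP.acyclic (n + 1)).epi_g
  dsimp at *
  obtain ⟨y, hy⟩ := (hom_acyclic_iff P Q).1 (hP.hom_acyclic Q inferInstance) (n + 1)
    (P.toCycles (n + 1 + 1) (n + 1) ≫ x) (by simp)
  refine ⟨y, (cancel_epi (P.toCycles (n + 1 + 1) (n + 1))).1 ?_⟩
  rw [P.toCycles_i_assoc, hy]

end Cycles

instance : (gorensteinProjective A).IsClosedUnderIsomorphisms where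
  of_iso := by
    rintro M N e ⟨P, hP, i, ⟨e'⟩⟩
    exact ⟨P, hP, i, ⟨e.symm ≪≫ e'⟩⟩

section

variable [HasExt.{w} A]

variable (A) in
lemma isProjectivelyResolved_gorensteinProjective :
    IsProjectivelyResolved (gorensteinProjective A) where
  ext_eq_zero := by
    rintro M ⟨P, hP, i, ⟨e'⟩⟩ Q _ e
    rw [← e.mk₀_id_comp, ← e'.hom_inv_id, ← Ext.mk₀_comp_mk₀_assoc,
      hP.ext_cycles_eq_zero i Q ((Ext.mk₀ e'.inv).comp e (zero_add 1)), Ext.comp_zero]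
  exists_left := by
    rintro M ⟨P, hP, i, ⟨e⟩⟩
    exact ⟨_, _, _, _, _, ⟨P, hP, i + 1, ⟨Iso.refl _⟩⟩, hP.projective _,
      shortExact_comp_iso (shortExact_cycles hP.acyclic i) e.symm⟩
  exists_right := by
    rintro M ⟨P, hP, i, ⟨e⟩⟩
    obtain ⟨n, rfl⟩ : ∃ n, i = n + 1 := ⟨i - 1, by simp⟩
    exact ⟨_, _, _, _, _, ⟨P, hP, n, ⟨Iso.refl _⟩⟩, hP.projective _,
      shortExact_iso_comp (shortExact_cycles hP.acyclic n) e⟩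

namespace IsProjectivelyResolved

/-- The split sequence on `M ⊞ M` resolves `M` by itself on both sides. -/
lemma projective : IsProjectivelyResolved (fun M : A => Projective M) where
  ext_eq_zero _ _ _ e := e.eq_zero_of_projective
  exists_left {M} hM := ⟨M, M ⊞ M, _, _, _, hM, inferInstance, shortExact_biprod M M⟩
  exists_right {M} hM := ⟨M ⊞ M, M, _, _, _, hM, inferInstance, shortExact_biprod M M⟩

variable {W : ObjectProperty A} [W.IsClosedUnderIsomorphisms]

/-- Horseshoe lemma on both sides: the resolutions of the two ends combine to one of the middle
term, and the new kernel or cokernel is again an extension of objects of `W`. -/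
lemma extension (hW : IsProjectivelyResolved W) :
    IsProjectivelyResolved (fun Y : A => ∃ (X Z : A) (f : X ⟶ Y) (g : Y ⟶ Z) (w : f ≫ g = 0),
      W X ∧ W Z ∧ (ShortComplex.mk f g w).ShortExact) where
  ext_eq_zero := by
    rintro Y ⟨X, Z, f, g, w, hX, hZ, h⟩ Q _ e
    obtain ⟨e', rfl⟩ := Ext.contravariant_sequence_exact₂ h Q e (hW.ext_eq_zero hX Q _)
    rw [hW.ext_eq_zero hZ Q e', Ext.comp_zero]
  exists_left := by
    rintro Y ⟨X, Z, f, g, w, hX, hZ, h⟩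
    obtain ⟨K₁, P₁, i₁, p₁, w₁, hK₁, hP₁, h₁⟩ := hW.exists_left hX
    obtain ⟨K₃, P₃, i₃, p₃, w₃, hK₃, hP₃, h₃⟩ := hW.exists_left hZ
    have : Epi g := h.epi_g
    have : Epi p₁ := h₁.epi_g
    have : Epi p₃ := h₃.epi_g
    let φ : ShortComplex.mk (biprod.inl : P₁ ⟶ P₁ ⊞ P₃) biprod.snd (by simp) ⟶
        ShortComplex.mk f g w :=
      { τ₁ := p₁
        τ₂ := biprod.desc (p₁ ≫ f) (Projective.factorThru p₃ g)
        τ₃ := p₃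
        comm₂₃ := by
          dsimp
          ext <;> simp [w] }
    have : Epi φ.τ₁ := h₁.epi_g
    have : Epi φ.τ₃ := h₃.epi_g
    obtain ⟨R, ψ, w', hR, hR₁, hR₂, hR₃⟩ := exists_shortExact_of_epi (shortExact_biprod P₁ P₃) h φ
    exact ⟨R.X₂, P₁ ⊞ P₃, _, _, _, ⟨R.X₁, R.X₃, _, _, _,
      W.prop_of_iso (h₁.fIsKernel.conePointUniqueUpToIso hR₁.fIsKernel) hK₁,
      W.prop_of_iso (h₃.fIsKernel.conePointUniqueUpToIso hR₃.fIsKernel) hK₃, hR⟩,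
      inferInstance, hR₂⟩
  exists_right := by
    rintro Y ⟨X, Z, f, g, w, hX, hZ, h⟩
    obtain ⟨P₁, C₁, i₁, p₁, w₁, hC₁, hP₁, h₁⟩ := hW.exists_right hX
    obtain ⟨P₃, C₃, i₃, p₃, w₃, hC₃, hP₃, h₃⟩ := hW.exists_right hZ
    -- The dual horseshoe needs `i₁` to extend to the middle term; `P₁` is not injective, and `Ext Z
    -- P₁ 1 = 0` takes the place of injectivity.
    obtain ⟨y, hy⟩ := exists_extension h (hW.ext_eq_zero hZ P₁) i₁
    dsimp at y hy
    let φ : ShortComplex.mk f g w ⟶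
        ShortComplex.mk (biprod.inl : P₁ ⟶ P₁ ⊞ P₃) biprod.snd (by simp) :=
      { τ₁ := i₁
        τ₂ := biprod.lift y (g ≫ i₃)
        τ₃ := i₃
        comm₁₂ := by
          dsimp
          ext <;> simp [hy, reassoc_of% w] }
    have : Mono φ.τ₁ := h₁.mono_f
    have : Mono φ.τ₃ := h₃.mono_f
    obtain ⟨R, ψ, w', hR, hR₁, hR₂, hR₃⟩ :=
      exists_shortExact_of_mono h (shortExact_biprod P₁ P₃) φ
    exact ⟨P₁ ⊞ P₃, R.X₂, _, _, _, ⟨R.X₁, R.X₃, _, _, _,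
      W.prop_of_iso (h₁.gIsCokernel.coconePointUniqueUpToIso hR₁.gIsCokernel) hC₁,
      W.prop_of_iso (h₃.gIsCokernel.coconePointUniqueUpToIso hR₃.gIsCokernel) hC₃, hR⟩,
      inferInstance, hR₂⟩

end IsProjectivelyResolved

end

lemma gorensteinProjective_of_projective (M : A) [Projective M] : gorensteinProjective A M := by
  let := HasExt.standard A
  exact IsProjectivelyResolved.projective.le_gorensteinProjective _ ‹Projective M›

lemma gorensteinProjective_of_isZero {M : A} (h : IsZero M) : gorensteinProjective A M := by
  have : Projective M := ⟨fun _ _ _ => ⟨0, h.eq_of_src _ _⟩⟩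
  exact gorensteinProjective_of_projective M

/-- Gorenstein projective objects are closed under extensions. -/
lemma gorensteinProjective_X₂ {S : ShortComplex A} (hS : S.ShortExact)
    (h₁ : gorensteinProjective A S.X₁) (h₃ : gorensteinProjective A S.X₃) :
    gorensteinProjective A S.X₂ := by
  let := HasExt.standard A
  exact (isProjectivelyResolved_gorensteinProjective A).extension.le_gorensteinProjective _
    ⟨_, _, _, _, _, h₁, h₃, hS⟩

end GorensteinWaldhausen

/-! ### Cokernels and pushouts of monomorphisms. -/

namespace GorensteinWaldhausen

open CategoryTheory.Abelian ZeroObject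

universe w

variable {A : Type u} [Category.{v} A] [Abelian A]

lemma shortExact_cokernel {X Y : A} (f : X ⟶ Y) [Mono f] :
    (ShortComplex.mk f (cokernel.π f) (cokernel.condition f)).ShortExact where
  exact := ShortComplex.exact_cokernel f

lemma shortExact_kernel {X Y : A} (f : X ⟶ Y) [Epi f] :
    (ShortComplex.mk (kernel.ι f) f (kernel.condition f)).ShortExact where
  exact := ShortComplex.exact_kernel f

/-- The third term of a short exact sequence is the cokernel of the first map. -/
noncomputable def cokernelIsoX₃ {S : ShortComplex A} (hS : S.ShortExact) :
    cokernel S.f ≅ S.X₃ :=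
  (cokernelIsCokernel S.f).coconePointUniqueUpToIso hS.gIsCokernel

lemma gorensteinProjective_cokernel_comp {X Y Z : A} (f : X ⟶ Y) (g : Y ⟶ Z) [Mono f] [Mono g]
    (hf : gorensteinProjective A (cokernel f)) (hg : gorensteinProjective A (cokernel g)) :
    gorensteinProjective A (cokernel (f ≫ g)) := by
  -- Comparing `X = X ⟶ 0` with `Y ⟶ Z ⟶ cokernel g` exhibits `cokernel (f ≫ g)` as an extension of
  -- `cokernel g` by `cokernel f`.
  have hS : (ShortComplex.mk (𝟙 X) (0 : X ⟶ (0 : A)) (by simp)).ShortExact :=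
    (ShortComplex.Splitting.mk (𝟙 X) 0 (by simp) ((isZero_zero A).eq_of_src _ _)
      (by simp) : ShortComplex.Splitting _).shortExact
  let φ : ShortComplex.mk (𝟙 X) (0 : X ⟶ (0 : A)) (by simp) ⟶
      ShortComplex.mk g (cokernel.π g) (cokernel.condition g) :=
    { τ₁ := f
      τ₂ := f ≫ g
      τ₃ := 0 }
  have : Mono φ.τ₁ := inferInstanceAs (Mono f)
  have : Mono φ.τ₃ := ⟨fun _ _ _ => (isZero_zero A).eq_of_tgt _ _⟩
  obtain ⟨R, ψ, w', hR, hR₁, hR₂, hR₃⟩ := exists_shortExact_of_mono hS (shortExact_cokernel g) φ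
  have h₃ : IsIso ψ.τ₃ := by
    have := hR₃.epi_g
    have := hR₃.exact.mono_g rfl
    exact isIso_of_mono_of_epi ψ.τ₃
  exact (gorensteinProjective A).prop_of_iso (cokernelIsoX₃ hR₂).symm
    (gorensteinProjective_X₂ hR
      ((gorensteinProjective A).prop_of_iso (cokernelIsoX₃ hR₁) hf)
      ((gorensteinProjective A).prop_of_iso (asIso ψ.τ₃) hg))

section Pushout

variable {X Y Z W : A} {f : X ⟶ Y} {g : X ⟶ Z} {t : Y ⟶ W} {s : Z ⟶ W}

lemma mono_of_isPushout (sq : IsPushout f g t s) [hf : Mono f] : Mono s :=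
  (MorphismProperty.monomorphisms A).of_isPushout sq.flip hf

lemma gorensteinProjective_cokernel_of_isPushout (sq : IsPushout f g t s)
    (hf : gorensteinProjective A (cokernel f)) : gorensteinProjective A (cokernel s) := by
  have := isIso_cokernel_map_of_isPushout sq
  exact (gorensteinProjective A).prop_of_iso (asIso (cokernel.map _ _ _ _ sq.w)) hf

lemma gorensteinProjective_of_isPushout (sq : IsPushout f g t s) [Mono f]
    (hf : gorensteinProjective A (cokernel f)) (hZ : gorensteinProjective A Z) :
    gorensteinProjective A W :=
  have := mono_of_isPushout sq
  gorensteinProjective_X₂ (shortExact_cokernel s) hZ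
    (gorensteinProjective_cokernel_of_isPushout sq hf)

/-- The property passes to the cokernels of `f` and `f'` by `τ₃`, to those of `s` and `s'` because
pushouts preserve cokernels, and then to the middle map `δ` by `τ₂`. -/
lemma EventuallyExtIso.of_isPushout [HasExt.{w} A] {X' Y' Z' W' : A}
    {f' : X' ⟶ Y'} {g' : X' ⟶ Z'} {t' : Y' ⟶ W'} {s' : Z' ⟶ W'}
    {α : X ⟶ X'} {β : Y ⟶ Y'} {γ : Z ⟶ Z'} {δ : W ⟶ W'}
    (sq : IsPushout f g t s) (sq' : IsPushout f' g' t' s') [Mono f] [Mono f']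
    (hf : f ≫ β = α ≫ f') (ht : t ≫ δ = β ≫ t') (hs : s ≫ δ = γ ≫ s')
    (hα : EventuallyExtIso α) (hβ : EventuallyExtIso β) (hγ : EventuallyExtIso γ) :
    EventuallyExtIso δ := by
  have := mono_of_isPushout sq
  have := mono_of_isPushout sq'
  have := isIso_cokernel_map_of_isPushout sq
  have := isIso_cokernel_map_of_isPushout sq'
  let φ : ShortComplex.mk f (cokernel.π f) (cokernel.condition f) ⟶
      ShortComplex.mk f' (cokernel.π f') (cokernel.condition f') :=
    { τ₁ := α
      τ₂ := β
      τ₃ := cokernel.map f f' α β hf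
      comm₁₂ := hf.symm }
  let ψ : ShortComplex.mk s (cokernel.π s) (cokernel.condition s) ⟶
      ShortComplex.mk s' (cokernel.π s') (cokernel.condition s') :=
    { τ₁ := γ
      τ₂ := δ
      τ₃ := cokernel.map s s' γ δ hs
      comm₁₂ := hs.symm }
  have h₁ : EventuallyExtIso (cokernel.map f f' α β hf) :=
    τ₃ (shortExact_cokernel f) (shortExact_cokernel f') φ hα hβ
  have h₂ : EventuallyExtIso (cokernel.map s s' γ δ hs) := by
    refine of_comp_right (of_isIso (cokernel.map _ _ _ _ sq.w)) ?_
    have e : cokernel.map _ _ _ _ sq.w ≫ cokernel.map s s' γ δ hs =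
        cokernel.map f f' α β hf ≫ cokernel.map _ _ _ _ sq'.w := by
      ext
      simp [reassoc_of% ht]
    rw [e]
    exact h₁.comp (of_isIso _)
  exact τ₂ (shortExact_cokernel s) (shortExact_cokernel s') ψ hγ h₂

end Pushout

/-! ### Factorization through a projective cover of the target. -/

section ProjectiveCover

variable [EnoughProjectives A]

instance epi_biprod_desc_π {X Y : A} (f : X ⟶ Y) : Epi (biprod.desc f (Projective.π Y)) := by
  have : Epi (biprod.inr ≫ biprod.desc f (Projective.π Y)) := by
    rw [biprod.inr_desc]
    infer_instance
  exact epi_of_epi biprod.inr _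

/-- The inclusion of `X` has projective cokernel, so two-out-of-three transfers the property from
`f` to the epimorphism `biprod.desc`, and `finitePd_X₁` applies to its kernel. -/
lemma EventuallyExtIso.finitePd_kernel [HasExt.{w} A] {X Y : A} {f : X ⟶ Y}
    (hf : EventuallyExtIso f) : finitePd A (kernel (biprod.desc f (Projective.π Y))) := by
  have hP : finitePd A (Projective.over Y) :=
    ⟨0, (projective_iff_hasProjectiveDimensionLE_zero _).1 inferInstance⟩
  have hi : EventuallyExtIso (biprod.inl : X ⟶ X ⊞ Projective.over Y) :=
    of_shortExact_of_finitePd_X₃ (shortExact_biprod X (Projective.over Y)) hP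
  have hp : EventuallyExtIso (biprod.desc f (Projective.π Y)) :=
    hi.of_comp_right (by rwa [biprod.inl_desc])
  exact finitePd_X₁ (shortExact_kernel (biprod.desc f (Projective.π Y))) hp

end ProjectiveCover

/-! ### The Waldhausen structure. -/

namespace GP

lemma cof_iff {X Y : GP A} (f : X ⟶ Y) :
    GP.cof A f ↔ Mono f.hom ∧ gorensteinProjective A (cokernel f.hom) :=
  Iff.rfl

lemma weq_iff [EnoughProjectives A] [HasExt.{w} A] {X Y : GP A} (f : X ⟶ Y) :
    GP.weq A f ↔ EventuallyExtIso f.hom := by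
  constructor
  · rintro ⟨M, i, p, ⟨hi, hi'⟩, ⟨hp, hp'⟩, fac⟩
    have e : f.hom = i.hom ≫ p.hom := congr_arg (fun k => k.hom) fac.symm
    rw [e]
    have hi'' : finitePd A (cokernel i.hom) := ⟨0, inferInstance⟩
    exact (EventuallyExtIso.of_shortExact_of_finitePd_X₃ (shortExact_cokernel i.hom) hi'').comp
      (EventuallyExtIso.of_shortExact_of_finitePd_X₁ (shortExact_kernel p.hom) hp')
  · intro hf
    -- The middle object of the factorization is Gorenstein projective, so it lies in `GPFin A`.
    have hM : gorensteinProjective A (X.obj ⊞ Projective.over Y.obj) :=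
      gorensteinProjective_X₂ (shortExact_biprod _ _) X.property
        (gorensteinProjective_of_projective _)
    refine ⟨(GP.incl A).obj ⟨_, hM⟩, ObjectProperty.homMk biprod.inl,
      ObjectProperty.homMk (biprod.desc f.hom (Projective.π Y.obj)), ⟨?_, ?_⟩, ⟨?_, ?_⟩, ?_⟩
    · exact inferInstanceAs (Mono biprod.inl)
    · exact Projective.of_iso (cokernelIsoX₃ (shortExact_biprod X.obj _)).symm
        (Projective.projective_over Y.obj)
    · exact epi_biprod_desc_π f.hom
    · exact hf.finitePd_kernel
    · ext
      exact biprod.inl_desc _ _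

variable {X Y Z : GP A}

/-- A pushout in `A` of a cofibration of `GP(A)` is a pushout in `GP(A)`. -/
lemma exists_isPushout (f : X ⟶ Y) (g : X ⟶ Z) (hf : GP.cof A f) :
    ∃ (W : GP A) (t : Y ⟶ W) (s : Z ⟶ W), IsPushout f g t s ∧
      IsPushout f.hom g.hom t.hom s.hom := by
  have := ((cof_iff f).1 hf).1
  have sq := IsPushout.of_hasPushout f.hom g.hom
  let W : GP A := ⟨_, gorensteinProjective_of_isPushout sq hf.2 Z.property⟩
  let t : Y ⟶ W := ObjectProperty.homMk (pushout.inl f.hom g.hom)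
  let s : Z ⟶ W := ObjectProperty.homMk (pushout.inr f.hom g.hom)
  refine ⟨W, t, s, ?_, sq⟩
  exact IsPushout.of_map (gorensteinProjective A).ι (by ext; exact sq.w) sq

/-- By uniqueness of pushouts, any pushout in `GP A` is isomorphic to the one computed in `A`. -/
lemma isPushout_hom {W : GP A} {f : X ⟶ Y} {g : X ⟶ Z} {t : Y ⟶ W} {s : Z ⟶ W}
    (sq : IsPushout f g t s) (hf : GP.cof A f) : IsPushout f.hom g.hom t.hom s.hom := by
  obtain ⟨W', t', s', sq', h⟩ := exists_isPushout f g hf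
  let e := sq'.isoIsPushout _ _ sq
  refine h.of_iso (Iso.refl _) (Iso.refl _) (Iso.refl _) ((gorensteinProjective A).ι.mapIso e)
    (by simp) (by simp) ?_ ?_
  · rw [Iso.refl_hom, Category.id_comp]
    exact congr_arg (fun k => k.hom) (sq'.inl_isoIsPushout_hom _ _ sq)
  · rw [Iso.refl_hom, Category.id_comp]
    exact congr_arg (fun k => k.hom) (sq'.inr_isoIsPushout_hom _ _ sq)

lemma isZero_of_isZero_obj {X : GP A} (h : IsZero X.obj) : IsZero X :=
  ⟨fun Y => ⟨⟨⟨ObjectProperty.homMk 0⟩, fun k => by ext; exact h.eq_of_src _ _⟩⟩,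
    fun Y => ⟨⟨⟨ObjectProperty.homMk 0⟩, fun k => by ext; exact h.eq_of_tgt _ _⟩⟩⟩

variable [EnoughProjectives A]

lemma isWaldhausenCategory (pt : GP A) (hpt : IsZero pt.obj) :
    IsWaldhausenCategory pt (GP.cof A) (GP.weq A) := by
  -- The statement does not mention Ext, so any choice of universe for the Ext groups will do.
  let := HasExt.standard A
  exact {
    isZero_pt := isZero_of_isZero_obj hpt
    cof_of_isIso := fun f hf => by
      have : IsIso f.hom := inferInstance
      exact ⟨inferInstance, gorensteinProjective_of_isZero (isZero_cokernel_of_epi f.hom)⟩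
    cof_comp := fun f g ⟨hf, hf'⟩ ⟨hg, hg'⟩ =>
      have : Mono f.hom := hf
      have : Mono g.hom := hg
      ⟨mono_comp f.hom g.hom, gorensteinProjective_cokernel_comp f.hom g.hom hf' hg'⟩
    cof_from_pt := fun {X} f => by
      have hf : f.hom = 0 := hpt.eq_of_src _ _
      refine ⟨⟨fun _ _ _ => hpt.eq_of_tgt _ _⟩, ?_⟩
      have : IsIso (cokernel.π f.hom) := by
        rw [hf]
        infer_instance
      exact (gorensteinProjective A).prop_of_iso (asIso (cokernel.π f.hom)) X.property
    hasPushout_of_cof := fun f g hf => by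
      obtain ⟨W, t, s, sq, -⟩ := exists_isPushout f g hf
      exact sq.hasPushout
    cof_cobaseChange := fun sq hf =>
      have := ((cof_iff _).1 hf).1
      have sq' := isPushout_hom sq hf
      ⟨mono_of_isPushout sq', gorensteinProjective_cokernel_of_isPushout sq' hf.2⟩
    weq_of_isIso := fun f hf => by
      rw [weq_iff]
      exact EventuallyExtIso.of_isIso f.hom
    weq_comp := fun f g hf hg => by
      rw [weq_iff] at *
      exact hf.comp hg
    gluing := fun sq sq' hf hf' h₁ _ h₃ h₄ hα hβ hγ => by
      rw [weq_iff] at *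
      have := ((cof_iff _).1 hf).1
      have := ((cof_iff _).1 hf').1
      exact EventuallyExtIso.of_isPushout (isPushout_hom sq hf) (isPushout_hom sq' hf')
        (congr_arg (fun k => k.hom) h₁) (congr_arg (fun k => k.hom) h₃)
        (congr_arg (fun k => k.hom) h₄) hα hβ hγ }

variable (A) in
lemma saturationAxiom : SaturationAxiom (GP.weq A) := by
  let := HasExt.standard A
  exact {
    comp := fun f g hf hg => by
      rw [weq_iff] at *
      exact hf.comp hg
    left := fun f g hg h => by
      rw [weq_iff] at *
      exact hg.of_comp_left h
    right := fun f g hf h => by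
      rw [weq_iff] at *
      exact hf.of_comp_right h }

end GP

end GorensteinWaldhausen
theorem mainTheorem7 {A : Type u} [Category.{v} A] [Abelian A] [EnoughProjectives A]
    (pt : A) (hpt : IsZero pt) :
    ∃ h : GorensteinWaldhausen.gorensteinProjective A pt,
      GorensteinWaldhausen.IsWaldhausenCategory
        (⟨pt, h⟩ : GorensteinWaldhausen.GP A)
        (GorensteinWaldhausen.GP.cof A) (GorensteinWaldhausen.GP.weq A) ∧
      GorensteinWaldhausen.SaturationAxiom (GorensteinWaldhausen.GP.weq A) := by
  exact ⟨GorensteinWaldhausen.gorensteinProjective_of_isZero hpt,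
    GorensteinWaldhausen.GP.isWaldhausenCategory _ hpt, GorensteinWaldhausen.GP.saturationAxiom A⟩
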